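/- Let $M$ be a smooth manifold (finite-dimensional, Hausdorff, second countable), let $A\to M$ be a real vector bundle of rank $n$, and let $\mathcal{A}=(A,\phi,[-,-],\rho,\alpha)$ be a regular hom-Lie algebroid. That is: $\phi:M\to M$ is a diffeomorphism; $\alpha:\Gamma A\to\Gamma A$ is a linear bijection with $\alpha(fx)=\phi^*(f)\alpha(x)$; $[-,-]$ is a skew-symmetric $\mathbb{R}$-bilinear bracket on $\Gamma A$ with $\alpha[x,y]=[\alpha(x),\alpha(y)]$ and $[\alpha(x),[y,z]]+[\alpha(y),[z,x]]+[\alpha(z),[x,y]]=0$; and $\rho:\phi^!A\to\phi^!TM$ is a bundle map such that, with $\rho(x)[f](m)=\langle d_{\phi(m)}f,\rho_m(x_{\phi(m)})\rangle$, $$[x,fy]=\phi^*(f)[x,y]+\rho(x)[f]\,\alpha(y),\quad \rho(\alpha(x))[\phi^*f]=\phi^*(\rho(x)[f]),\quad \rho([x,y])[\phi^*f]=\rho(\alpha(x))[\rho(y)[f]]-\rho(\alpha(y))[\rho(x)[f]].$$ Let $\tilde\alpha$ be the multiplicative extension of $\alpha$ to $\mathfrak{A}=\bigoplus_{k\ge0}\Gamma(\wedge^kA)$,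 with $\tilde\alpha(f)=\phi^*(f)$ in degree $0$, and let $[-,-]_{\mathcal A}$ be the associated hom-Gerstenhaber bracket on $(\mathfrak{A},\wedge,\tilde\alpha)$, i.e. the one that extends $[-,-]$ and satisfies $[x,f]_{\mathcal A}=\rho(x)[f]$ for $x\in\Gamma A$, $f\in C^\infty(M)$. A representation of $\mathcal{A}$ on the hom-bundle $(\wedge^nA,\phi,\tilde\alpha)$ is an $\mathbb{R}$-bilinear map $\nabla:\Gamma A\times\Gamma(\wedge^nA)\to\Gamma(\wedge^nA)$ with $\nabla_{fx}X=\phi^*(f)\nabla_xX$, $\nabla_x(fX)=\phi^*(f)\nabla_xX+\rho(x)[f]\,\tilde\alpha(X)$, $\nabla_{\alpha(x)}\tilde\alpha(X)=\tilde\alpha(\nabla_xX)$ and $\nabla_{[x,y]}\tilde\alpha(X)=\nabla_{\alpha(x)}\nabla_yX-\nabla_{\alpha(y)}\nabla_xX$. Let $D_\nabla$ be the exact generator of $[-,-]_{\mathcal A}$ corresponding to $\nabla$: the operator of degree $-1$ on $\mathfrak{A}$ with $D_\nabla^2=0$, $D_\nabla\tilde\alpha=\tilde\alpha D_\nabla$,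 $$[X,Y]_{\mathcal A}=(-1)^{|X|}\big(D_\nabla(X\wedge Y)-D_\nabla(X)\wedge\tilde\alpha(Y)-(-1)^{|X|}\tilde\alpha(X)\wedge D_\nabla(Y)\big)$$ for homogeneous $X,Y\in\mathfrak{A}$, and $D_\nabla(x)\,\tilde\alpha(X)=[x,X]_{\mathcal A}-\nabla_xX$ for $x\in\Gamma A$, $X\in\Gamma(\wedge^nA)$. Let $H^\nabla_*(\mathcal{A})$ be the homology of the chain complex $(\bigoplus_{k\ge0}\Gamma(\wedge^kA),D_\nabla)$. For $f\in C^\infty(M)$ put $(df)(x)=\rho(\alpha^{-1}(x))[f]$. Two representations $\nabla^1,\nabla^2$ of $\mathcal{A}$ on $(\wedge^nA,\phi,\tilde\alpha)$ are called homotopic if there is $f\in C^\infty(M)$ such that $$\nabla^1_xX-\nabla^2_xX=\phi^*\big((df)(x)\big)\,\tilde\alpha(X)\qquad\text{for all }x\in\Gamma A,\ X\in\Gamma(\wedge^nA).$$ Theorem. If $\nabla^1$ and $\nabla^2$ are homotopic, then $H^{\nabla^1}_k(\mathcal{A})\cong H^{\nabla^2}_k(\mathcal{A})$ for every $k\ge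 0$. More precisely, for every $f$ as above, multiplication by $e^f$ on cycles induces an isomorphism of real vector spaces $H^{\nabla^1}_k(\mathcal{A})\to H^{\nabla^2}_k(\mathcal{A})$, $[\lambda]\mapsto[e^f\lambda]$. -/

import Mathlib

open scoped Manifold ContDiff Bundle

noncomputable section

namespace HomLie

/-! ### Hom-Lie-Rinehart algebras and the hom-Gerstenhaber structure on the exterior algebra -/

/-- A hom-Lie-Rinehart algebra over `(R, φ)` with underlying `R`-module `L`
(over the ground field `ℝ`). -/
structure HomLieRinehart (R L : Type*) [CommRing R] [Algebra ℝ R] [AddCommGroup L]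
    [Module R L] [Module ℝ L] [IsScalarTower ℝ R L] where
  /-- the algebra endomorphism of `R` -/
  φ : R →ₐ[ℝ] R
  /-- the twisting map of `L` -/
  α : L →ₗ[ℝ] L
  /-- the bracket of `L` -/
  bracket : L →ₗ[ℝ] L →ₗ[ℝ] L
  /-- the anchor, `ρ x f` is `ρ(x)[f]` -/
  ρ : L →ₗ[ℝ] R →ₗ[ℝ] R
  ρ_mul : ∀ x f g, ρ x (f * g) = φ f * ρ x g + φ g * ρ x f
  α_smul : ∀ (f : R) (x : L), α (f • x) = φ f • α x
  bracket_skew : ∀ x y, bracket x y = -bracket y x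
  α_bracket : ∀ x y, α (bracket x y) = bracket (α x) (α y)
  jacobi : ∀ x y z, bracket (α x) (bracket y z) + bracket (α y) (bracket z x)
    + bracket (α z) (bracket x y) = 0
  ρ_α : ∀ x f, ρ (α x) (φ f) = φ (ρ x f)
  ρ_bracket : ∀ x y f, ρ (bracket x y) (φ f) = ρ (α x) (ρ y f) - ρ (α y) (ρ x f)
  ρ_smul : ∀ (f : R) (x : L) (g : R), ρ (f • x) g = φ f * ρ x g
  leibniz : ∀ (x : L) (f : R) (y : L),
    bracket x (f • y) = φ f • bracket x y + ρ x f • α y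

namespace HomLieRinehart

variable {R L : Type*} [CommRing R] [Algebra ℝ R] [AddCommGroup L]
    [Module R L] [Module ℝ L] [IsScalarTower ℝ R L] (𝒜 : HomLieRinehart R L)

/-- `𝒜` is regular: `φ` is an automorphism and `α` is a bijection. -/
structure IsRegular : Prop where
  bijective_φ : Function.Bijective 𝒜.φ
  bijective_α : Function.Bijective 𝒜.α

/-- The ring `⋀ L`, regarded below as an `R`-algebra through `φ`. -/
def Twist (_ : HomLieRinehart R L) : Type _ := ExteriorAlgebra R L

instance : Ring 𝒜.Twist := inferInstanceAs (Ring (ExteriorAlgebra R L))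

instance : Algebra R 𝒜.Twist :=
  RingHom.toAlgebra' (((algebraMap R (ExteriorAlgebra R L)).comp (𝒜.φ : R →+* R)))
    fun c x => Algebra.commutes (A := ExteriorAlgebra R L) (𝒜.φ c) x

/-- `x ↦ α x`, as an `R`-linear map into the twisted exterior algebra. -/
def ιTwist : L →ₗ[R] 𝒜.Twist where
  toFun x := (ExteriorAlgebra.ι R (𝒜.α x) : ExteriorAlgebra R L)
  map_add' x y := by
    rw [map_add, map_add]; rfl
  map_smul' f x := by
    rw [𝒜.α_smul, map_smul, Algebra.smul_def]; rfl

/-- The extension `α̃` of `α` to the exterior algebra: the ring endomorphism with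
`α̃ f = φ f` for `f : R` and `α̃ (x₁ ∧ ⋯ ∧ xₖ) = α x₁ ∧ ⋯ ∧ α xₖ`. -/
def αExt : ExteriorAlgebra R L →+* ExteriorAlgebra R L :=
  (ExteriorAlgebra.lift R ⟨𝒜.ιTwist, fun x =>
    ExteriorAlgebra.ι_sq_zero (R := R) (𝒜.α x)⟩ : ExteriorAlgebra R L →ₐ[R] 𝒜.Twist).toRingHom

theorem αExt_algebraMap (f : R) :
    𝒜.αExt (algebraMap R _ f) = algebraMap R _ (𝒜.φ f) :=
  AlgHom.commutes (ExteriorAlgebra.lift R ⟨𝒜.ιTwist, fun x =>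
    ExteriorAlgebra.ι_sq_zero (R := R) (𝒜.α x)⟩ : ExteriorAlgebra R L →ₐ[R] 𝒜.Twist) f

theorem αExt_ι (x : L) :
    𝒜.αExt (ExteriorAlgebra.ι R x) = ExteriorAlgebra.ι R (𝒜.α x) :=
  ExteriorAlgebra.lift_ι_apply (A := 𝒜.Twist) R 𝒜.ιTwist _ x

theorem αExt_mem (k : ℕ) {X : ExteriorAlgebra R L} (hX : X ∈ ⋀[R]^k L) :
    𝒜.αExt X ∈ ⋀[R]^k L := by
  rw [← ExteriorAlgebra.ιMulti_span_fixedDegree] at hX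
  induction hX using Submodule.span_induction with
  | mem X h =>
    obtain ⟨v, rfl⟩ := h
    have : 𝒜.αExt (ExteriorAlgebra.ιMulti R k v) =
        ExteriorAlgebra.ιMulti R k (fun i => 𝒜.α (v i)) := by
      simp [ExteriorAlgebra.ιMulti_apply, map_list_prod, List.map_ofFn, Function.comp_def, αExt_ι]
    rw [this]
    exact ExteriorAlgebra.ιMulti_range R k ⟨_, rfl⟩
  | zero => simp
  | add X Y _ _ hX hY => rw [map_add]; exact add_mem hX hY
  | smul f X _ hX =>
    rw [Algebra.smul_def, map_mul, αExt_algebraMap, ← Algebra.smul_def]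
    exact Submodule.smul_mem _ _ hX

/-- `α̃` on the exterior power `⋀ᵏ L`. -/
def αPow (k : ℕ) (X : ⋀[R]^k L) : ⋀[R]^k L := ⟨𝒜.αExt X, 𝒜.αExt_mem k X.2⟩

/-- A representation (left module structure) of `𝒜` on `(N, β)`; for a hom-Lie algebroid and
`N` the module of sections of a hom-bundle `(E, φ, β)`, this is a representation on that
hom-bundle. -/
structure Representation (N : Type*) [AddCommGroup N] [Module R N] [Module ℝ N]
    [IsScalarTower ℝ R N] (β : N → N) where
  /-- `nabla x s` is `∇ₓ s` -/
  nabla : L →ₗ[ℝ] N →ₗ[ℝ] N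
  smul_left : ∀ (f : R) x s, nabla (f • x) s = 𝒜.φ f • nabla x s
  smul_right : ∀ (f : R) x s, nabla x (f • s) = 𝒜.φ f • nabla x s + 𝒜.ρ x f • β s
  nabla_α : ∀ x s, nabla (𝒜.α x) (β s) = β (nabla x s)
  nabla_bracket : ∀ x y s, nabla (𝒜.bracket x y) (β s) =
    nabla (𝒜.α x) (nabla y s) - nabla (𝒜.α y) (nabla x s)

/-- A representation of `𝒜` on the `n`-th exterior power `(⋀ⁿ L, α̃)`. -/
abbrev TopRepresentation (n : ℕ) := 𝒜.Representation (⋀[R]^n L) (𝒜.αPow n)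

/-- `B` is the hom-Gerstenhaber bracket on `(⋀ L, ∧, α̃)` associated with `𝒜`: it makes `⋀ L` a
hom-Gerstenhaber algebra and extends the bracket and the anchor of `𝒜`. (Parities are written
as `i + 1` in place of `i - 1`.) -/
structure IsHomGerstenhaberBracket
    (B : ExteriorAlgebra R L →ₗ[ℝ] ExteriorAlgebra R L →ₗ[ℝ] ExteriorAlgebra R L) : Prop where
  degree : ∀ i j k, i + j = k + 1 → ∀ X ∈ ⋀[R]^i L, ∀ Y ∈ ⋀[R]^j L, B X Y ∈ ⋀[R]^k L
  degree_zero : ∀ X ∈ ⋀[R]^0 L, ∀ Y ∈ ⋀[R]^0 L, B X Y = 0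
  skew : ∀ i j, ∀ X ∈ ⋀[R]^i L, ∀ Y ∈ ⋀[R]^j L,
    B X Y = -((-1 : ℝ) ^ ((i + 1) * (j + 1)) • B Y X)
  map_α : ∀ X Y, 𝒜.αExt (B X Y) = B (𝒜.αExt X) (𝒜.αExt Y)
  jacobi : ∀ i j k, ∀ X ∈ ⋀[R]^i L, ∀ Y ∈ ⋀[R]^j L, ∀ Z ∈ ⋀[R]^k L,
    (-1 : ℝ) ^ ((i + 1) * (k + 1)) • B (𝒜.αExt X) (B Y Z)
      + (-1 : ℝ) ^ ((j + 1) * (i + 1)) • B (𝒜.αExt Y) (B Z X)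
      + (-1 : ℝ) ^ ((k + 1) * (j + 1)) • B (𝒜.αExt Z) (B X Y) = 0
  leibniz : ∀ i j, ∀ X ∈ ⋀[R]^i L, ∀ Y ∈ ⋀[R]^j L, ∀ Z,
    B X (Y * Z) = B X Y * 𝒜.αExt Z + (-1 : ℝ) ^ ((i + 1) * j) • (𝒜.αExt Y * B X Z)
  ι_ι : ∀ x y, B (ExteriorAlgebra.ι R x) (ExteriorAlgebra.ι R y)
    = ExteriorAlgebra.ι R (𝒜.bracket x y)
  ι_algebraMap : ∀ x f, B (ExteriorAlgebra.ι R x) (algebraMap R _ f)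
    = algebraMap R _ (𝒜.ρ x f)

/-- `D` is an exact generator of the bracket `B` on `(⋀ L, α̃)`. -/
structure IsExactGenerator
    (B : ExteriorAlgebra R L →ₗ[ℝ] ExteriorAlgebra R L →ₗ[ℝ] ExteriorAlgebra R L)
    (D : ExteriorAlgebra R L →ₗ[ℝ] ExteriorAlgebra R L) : Prop where
  degree : ∀ k, ∀ X ∈ ⋀[R]^(k + 1) L, D X ∈ ⋀[R]^k L
  degree_zero : ∀ X ∈ ⋀[R]^0 L, D X = 0
  comm_α : ∀ X, D (𝒜.αExt X) = 𝒜.αExt (D X)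
  generates : ∀ i, ∀ X ∈ ⋀[R]^i L, ∀ Y,
    B X Y = (-1 : ℝ) ^ i •
      (D (X * Y) - D X * 𝒜.αExt Y - (-1 : ℝ) ^ i • (𝒜.αExt X * D Y))
  sq_zero : ∀ X, D (D X) = 0

variable {𝒜}

namespace Representation

variable {n : ℕ} (rep rep₁ rep₂ : 𝒜.TopRepresentation n)

/-- `D` is the exact generator of the hom-Gerstenhaber bracket corresponding to the
representation `∇`: `D(a) α̃(X) = [a, X] - ∇ₐ X` for `a ∈ L` and `X ∈ ⋀ⁿ L`. -/
def IsGenerator (D : ExteriorAlgebra R L →ₗ[ℝ] ExteriorAlgebra R L) : Prop :=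
  ∃ B, 𝒜.IsHomGerstenhaberBracket B ∧ 𝒜.IsExactGenerator B D ∧
    ∀ (a : L) (X : ⋀[R]^n L),
      D (ExteriorAlgebra.ι R a) * 𝒜.αExt X = B (ExteriorAlgebra.ι R a) X - rep.nabla a X

open Classical in
/-- The operator `D_∇` of degree `-1` on `⋀ L`: the exact generator corresponding to `∇`, which
exists and is unique if `𝒜` is regular and `L` is projective of rank `n`. -/
def generator : ExteriorAlgebra R L →ₗ[ℝ] ExteriorAlgebra R L :=
  if h : ∃ D, rep.IsGenerator D then h.choose else 0

/-- The `k`-cycles of the complex `(⋀ L, D_∇)`. -/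
def cycles (k : ℕ) : Submodule ℝ (ExteriorAlgebra R L) :=
  (⋀[R]^k L).restrictScalars ℝ ⊓ LinearMap.ker rep.generator

/-- The `k`-boundaries of the complex `(⋀ L, D_∇)`. -/
def boundaries (k : ℕ) : Submodule ℝ (ExteriorAlgebra R L) :=
  ((⋀[R]^(k + 1) L).restrictScalars ℝ).map rep.generator

theorem boundaries_le_cycles (k : ℕ) : rep.boundaries k ≤ rep.cycles k := by
  rintro _ ⟨X, hX, rfl⟩
  by_cases h : ∃ D, rep.IsGenerator D
  · obtain ⟨B, -, hD, -⟩ := h.choose_spec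
    simp only [cycles, generator, dif_pos h]
    exact ⟨hD.degree k X hX, hD.sq_zero X⟩
  · simp [cycles, generator, dif_neg h]

/-- The homology `H_k^∇` of the chain complex `(⋀ L, D_∇)`. -/
abbrev Homology (k : ℕ) : Type _ :=
  ↥(rep.cycles k) ⧸ (rep.boundaries k).submoduleOf (rep.cycles k)

/-- The homology class of a cycle. -/
def homologyClass (k : ℕ) (z : rep.cycles k) : rep.Homology k :=
  Submodule.Quotient.mk z

end Representation

namespace IsRegular

/-- The inverse of `α`. -/
def αInv (h : 𝒜.IsRegular) : L →ₗ[ℝ] L :=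
  ((LinearEquiv.ofBijective 𝒜.α h.bijective_α).symm : L →ₗ[ℝ] L)

/-- The differential of `f` as a `1`-cochain of `𝒜` with trivial coefficients,
`(d f)(x) = ρ(α⁻¹ x)[f]`. -/
def d (h : 𝒜.IsRegular) (f : R) : L →ₗ[ℝ] R := (𝒜.ρ.flip f).comp h.αInv

end IsRegular

namespace Representation

variable {n : ℕ}

/-- The difference of `∇¹` and `∇²` is given by the exact `1`-form `d f`:
`∇¹ₓ X - ∇²ₓ X = i_{d f}(x) α̃(X)`, with `i_ξ(x) = φ (ξ x)`. -/
def IsHomotopy (h : 𝒜.IsRegular) (rep₁ rep₂ : 𝒜.TopRepresentation n) (f : R) : Prop :=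
  ∀ (x : L) (X : ⋀[R]^n L),
    rep₁.nabla x X - rep₂.nabla x X = 𝒜.φ (h.d f x) • 𝒜.αPow n X

/-- `∇¹` and `∇²` are homotopic. -/
def Homotopic (h : 𝒜.IsRegular) (rep₁ rep₂ : 𝒜.TopRepresentation n) : Prop :=
  ∃ f : R, IsHomotopy h rep₁ rep₂ f

end Representation

end HomLieRinehart

/-! ### Hom-Lie algebroids -/

section Algebroid

variable {d : ℕ} {M : Type*} [TopologicalSpace M] [ChartedSpace (EuclideanSpace ℝ (Fin d)) M]

/-- The algebra `C^∞(M)`. -/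
abbrev SmoothFn (d : ℕ) (M : Type*) [TopologicalSpace M]
    [ChartedSpace (EuclideanSpace ℝ (Fin d)) M] : Type _ :=
  C^∞⟮𝓡 d, M; 𝓘(ℝ, ℝ), ℝ⟯

/-- The exponential `e^f` of a smooth function. -/
def SmoothFn.exp (f : SmoothFn d M) : SmoothFn d M :=
  ⟨fun m => Real.exp (f m), Real.contDiff_exp.contMDiff.comp f.contMDiff⟩

/-- The pull-back `φ^* : C^∞(M) → C^∞(M)`. -/
def pullback (φ : C^∞⟮𝓡 d, M; 𝓡 d, M⟯) : SmoothFn d M →ₐ[ℝ] SmoothFn d M where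
  toFun f := f.comp φ
  map_one' := rfl
  map_mul' _ _ := rfl
  map_zero' := rfl
  map_add' _ _ := rfl
  commutes' _ := rfl

variable (d) (F : Type*) [NormedAddCommGroup F] [NormedSpace ℝ F]
  (V : M → Type*) [TopologicalSpace (Bundle.TotalSpace F V)]
  [∀ m, AddCommGroup (V m)] [∀ m, Module ℝ (V m)] [∀ m, TopologicalSpace (V m)]
  [FiberBundle F V] [VectorBundle ℝ F V]

/-- The space `Γ(V)` of smooth sections of the vector bundle `V` with model fibre `F`. -/
abbrev Sections : Type _ := Cₛ^∞⟮𝓡 d; F, V⟯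

instance : Module (SmoothFn d M) (Sections d F V) where
  smul f s := ⟨fun m => f m • s m, f.contMDiff.smul_section s.contMDiff⟩
  one_smul s := by ext m; exact one_smul ℝ (s m)
  mul_smul f g s := by ext m; exact mul_smul (f m) (g m) (s m)
  smul_zero f := by ext m; exact smul_zero (f m)
  smul_add f s t := by ext m; exact smul_add (f m) (s m) (t m)
  add_smul f g s := by ext m; exact add_smul (f m) (g m) (s m)
  zero_smul s := by ext m; exact zero_smul ℝ (s m)

variable {d F V} in
theorem smul_apply (f : SmoothFn d M) (s : Sections d F V) (m : M) : (f • s) m = f m • s m := rfl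

instance : IsScalarTower ℝ (SmoothFn d M) (Sections d F V) where
  smul_assoc c f s := by ext m; exact smul_assoc c (f m) (s m)

variable {d}

/-- A smooth bundle map `ρ : φ^! V → φ^! TM` over `M`, given by the linear maps
`ρ_m : V_{φ(m)} → T_{φ(m)} M`. -/
structure Anchor [IsManifold (𝓡 d) ∞ M] (φ : C^∞⟮𝓡 d, M; 𝓡 d, M⟯) where
  /-- the map `ρ_m` on fibres -/
  toFun : ∀ m, V (φ m) →ₗ[ℝ] TangentSpace (𝓡 d) (φ m)
  smooth : ∀ X : Sections d F V, ContMDiff (𝓡 d) (𝓡 d).tangent ∞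
    (fun m => (⟨φ m, toFun m (X (φ m))⟩ : TangentBundle (𝓡 d) M))

variable {F V}

section act

variable [IsManifold (𝓡 d) ∞ M] {φ : C^∞⟮𝓡 d, M; 𝓡 d, M⟯} (ρ : Anchor F V φ)

/-- The function `ρ(X)[f] : m ↦ ⟨d_{φ(m)} f, ρ_m (X_{φ(m)})⟩`. -/
def Anchor.act (X : Sections d F V) (f : SmoothFn d M) : SmoothFn d M where
  val m := mfderiv (𝓡 d) 𝓘(ℝ, ℝ) f (φ m) (ρ.toFun m (X (φ m)))
  property := (contMDiff_snd_tangentBundle_modelSpace ℝ 𝓘(ℝ, ℝ)).comp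
    ((f.contMDiff.contMDiff_tangentMap (m := ∞) le_rfl).comp (ρ.smooth X))

theorem Anchor.act_apply (X : Sections d F V) (f : SmoothFn d M) (m : M) :
    ρ.act X f m = mfderiv (𝓡 d) 𝓘(ℝ, ℝ) f (φ m) (ρ.toFun m (X (φ m))) := rfl

theorem Anchor.act_mul (X : Sections d F V) (f g : SmoothFn d M) :
    ρ.act X (f * g) = pullback φ f * ρ.act X g + pullback φ g * ρ.act X f := by
  ext m
  have hf : MDifferentiableAt (𝓡 d) 𝓘(ℝ, ℝ) f (φ m) := f.mdifferentiableAt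
  have hg : MDifferentiableAt (𝓡 d) 𝓘(ℝ, ℝ) g (φ m) := g.mdifferentiableAt
  have h := (hf.hasMFDerivAt.mul hg.hasMFDerivAt).mfderiv
  have h' : mfderiv (𝓡 d) 𝓘(ℝ, ℝ) (f * g : SmoothFn d M) (φ m) = _ := h
  exact DFunLike.congr_fun h' (ρ.toFun m (X (φ m)))

/-- `ρ(X)[f]` as a bilinear map. -/
def Anchor.actₗ : Sections d F V →ₗ[ℝ] SmoothFn d M →ₗ[ℝ] SmoothFn d M :=
  LinearMap.mk₂ ℝ ρ.act
    (fun X Y f => by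
      ext m
      simp only [Anchor.act_apply, ContMDiffMap.coe_add, Pi.add_apply, ContMDiffSection.coe_add,
        map_add]
      rfl)
    (fun c X f => by
      ext m
      simp only [Anchor.act_apply, ContMDiffMap.coe_smul, Pi.smul_apply,
        ContMDiffSection.coe_smul, map_smul]
      rfl)
    (fun X f g => by
      ext m
      have hf : MDifferentiableAt (𝓡 d) 𝓘(ℝ, ℝ) f (φ m) := f.mdifferentiableAt
      have hg : MDifferentiableAt (𝓡 d) 𝓘(ℝ, ℝ) g (φ m) := g.mdifferentiableAt
      have h' : mfderiv (𝓡 d) 𝓘(ℝ, ℝ) (f + g : SmoothFn d M) (φ m) = _ :=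
        (hf.hasMFDerivAt.add hg.hasMFDerivAt).mfderiv
      exact DFunLike.congr_fun h' (ρ.toFun m (X (φ m))))
    (fun c X f => by
      ext m
      have hf : MDifferentiableAt (𝓡 d) 𝓘(ℝ, ℝ) f (φ m) := f.mdifferentiableAt
      have h' : mfderiv (𝓡 d) 𝓘(ℝ, ℝ) (c • f : SmoothFn d M) (φ m) = _ :=
        (hf.hasMFDerivAt.const_smul c).mfderiv
      exact DFunLike.congr_fun h' (ρ.toFun m (X (φ m))))

end act

variable (d F V) in
/-- A hom-Lie algebroid `(V, φ, [-,-], ρ, α)` over the manifold `M`. -/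
structure HomLieAlgebroid [IsManifold (𝓡 d) ∞ M] where
  /-- the smooth map of the base -/
  φ : C^∞⟮𝓡 d, M; 𝓡 d, M⟯
  /-- the bracket on sections -/
  bracket : Sections d F V →ₗ[ℝ] Sections d F V →ₗ[ℝ] Sections d F V
  /-- the anchor -/
  anchor : Anchor F V φ
  /-- the twisting map on sections -/
  α : Sections d F V →ₗ[ℝ] Sections d F V
  α_smul : ∀ (f : SmoothFn d M) (X : Sections d F V), α (f • X) = pullback φ f • α X
  bracket_skew : ∀ X Y, bracket X Y = -bracket Y X
  α_bracket : ∀ X Y, α (bracket X Y) = bracket (α X) (α Y)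
  jacobi : ∀ X Y Z, bracket (α X) (bracket Y Z) + bracket (α Y) (bracket Z X)
    + bracket (α Z) (bracket X Y) = 0
  leibniz : ∀ (X : Sections d F V) (f : SmoothFn d M) (Y : Sections d F V),
    bracket X (f • Y) = pullback φ f • bracket X Y + anchor.act X f • α Y
  act_α : ∀ X f, anchor.act (α X) (pullback φ f) = pullback φ (anchor.act X f)
  act_bracket : ∀ X Y f, anchor.act (bracket X Y) (pullback φ f) =
    anchor.act (α X) (anchor.act Y f) - anchor.act (α Y) (anchor.act X f)

namespace HomLieAlgebroid

variable [IsManifold (𝓡 d) ∞ M] (𝒜 : HomLieAlgebroid d F V)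

/-- The hom-Lie-Rinehart algebra over `(C^∞(M), φ^*)` on the sections of a hom-Lie algebroid.
The exterior algebra of the `C^∞(M)`-module of sections is `⨁ₖ Γ(⋀ᵏ V)`. -/
def toHomLieRinehart : HomLieRinehart (SmoothFn d M) (Sections d F V) where
  φ := pullback 𝒜.φ
  α := 𝒜.α
  bracket := 𝒜.bracket
  ρ := 𝒜.anchor.actₗ
  ρ_mul := 𝒜.anchor.act_mul
  α_smul := 𝒜.α_smul
  bracket_skew := 𝒜.bracket_skew
  α_bracket := 𝒜.α_bracket
  jacobi := 𝒜.jacobi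
  ρ_α := 𝒜.act_α
  ρ_bracket := 𝒜.act_bracket
  ρ_smul f X g := by
    ext m
    change mfderiv (𝓡 d) 𝓘(ℝ, ℝ) g (𝒜.φ m) (𝒜.anchor.toFun m (f (𝒜.φ m) • X (𝒜.φ m))) = _
    rw [map_smul, map_smul]
    rfl
  leibniz := 𝒜.leibniz

/-- `𝒜` is regular: `α` is invertible and `φ` is a diffeomorphism. -/
structure IsRegular : Prop where
  bijective_α : Function.Bijective 𝒜.α
  diffeomorph_φ : ∃ Φ : M ≃ₘ^∞⟮𝓡 d, 𝓡 d⟯ M, ∀ m, Φ m = 𝒜.φ m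

variable {𝒜}

theorem IsRegular.toHomLieRinehart (h : 𝒜.IsRegular) : 𝒜.toHomLieRinehart.IsRegular where
  bijective_α := h.bijective_α
  bijective_φ := by
    obtain ⟨Φ, hΦ⟩ := h.diffeomorph_φ
    constructor
    · intro f g hfg
      ext m
      obtain ⟨m, rfl⟩ := Φ.surjective m
      have := DFunLike.congr_fun hfg m
      change f (Φ m) = g (Φ m)
      rw [hΦ]
      exact this
    · intro f
      refine ⟨f.comp ⟨Φ.symm, Φ.symm.contMDiff⟩, ?_⟩
      ext m
      change f (Φ.symm (𝒜.φ m)) = f m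
      rw [← hΦ, Φ.symm_apply_apply]

end HomLieAlgebroid

end Algebroid

end HomLie

end

noncomputable section

namespace HomLie

namespace HomLieRinehart

/-! ### Exterior powers under the extended twisting map. -/

variable {R L : Type*} [CommRing R] [Algebra ℝ R] [AddCommGroup L]
    [Module R L] [Module ℝ L] [IsScalarTower ℝ R L] {𝒜 : HomLieRinehart R L}

/-! Put `u = e^f`. The heart of the matter is the gauge formula `D₂ (u X) = φ u • D₁ X`. The
operator `φ u • D₁ (u⁻¹ • -)` generates the same bracket as `D₁` and changes `D₁ x` by `ρ(x)[f]`,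
the difference of the two representations. It squares to zero and commutes with `α̃` because `φ u /
u` is annihilated by the anchor: equivariance of both representations forces `ρ(x)[φ f] = ρ(x)[f]`
(`IsHomotopy.ρ_φ`, `ρ_φ_mul_inv`). So it is an exact generator for `∇²` (`isGenerator_twist`), and
`IsGenerator.unique` identifies it with `D₂`. Because of the factor `φ u` instead of `u`,
multiplication by `u` need not be a chain map. It clearly preserves cycles; boundaries are preserved
because `u / φ u` is again invisible to the anchor and can be pulled inside `D₁`. The inverse comes
from the symmetric data `(u⁻¹, -f)`. Geometry enters in two places: the chain rule for `e^f`, and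
faithfulness of the top exterior power of sections, on which uniqueness rests. -/

theorem αExt_smul (f : R) (X : ExteriorAlgebra R L) :
    𝒜.αExt (f • X) = 𝒜.φ f • 𝒜.αExt X := by
  rw [Algebra.smul_def, map_mul, αExt_algebraMap, ← Algebra.smul_def]

theorem αPow_smul {k : ℕ} (f : R) (X : ⋀[R]^k L) :
    𝒜.αPow k (f • X) = 𝒜.φ f • 𝒜.αPow k X :=
  Subtype.ext (αExt_smul f X.1)

theorem αPow_sub {k : ℕ} (X Y : ⋀[R]^k L) :
    𝒜.αPow k (X - Y) = 𝒜.αPow k X - 𝒜.αPow k Y :=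
  Subtype.ext (map_sub 𝒜.αExt X.1 Y.1)

theorem algebraMap_mem_zero (f : R) : algebraMap R (ExteriorAlgebra R L) f ∈ ⋀[R]^0 L := by
  rw [ExteriorAlgebra.exteriorPower, pow_zero, Submodule.mem_one]
  exact ⟨f, rfl⟩

theorem exists_eq_algebraMap {X : ExteriorAlgebra R L} (hX : X ∈ ⋀[R]^0 L) :
    ∃ f, X = algebraMap R _ f := by
  rw [ExteriorAlgebra.exteriorPower, pow_zero, Submodule.mem_one] at hX
  obtain ⟨f, rfl⟩ := hX
  exact ⟨f, rfl⟩

theorem ι_mem_one (x : L) : ExteriorAlgebra.ι R x ∈ ⋀[R]^1 L := by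
  rw [ExteriorAlgebra.exteriorPower, pow_one]
  exact ⟨x, rfl⟩

theorem IsRegular.αPow_surjective (h : 𝒜.IsRegular) (k : ℕ) :
    Function.Surjective (𝒜.αPow k) := by
  rintro ⟨X, hX⟩
  suffices ∃ Y ∈ ⋀[R]^k L, 𝒜.αExt Y = X by
    obtain ⟨Y, hY, rfl⟩ := this
    exact ⟨⟨Y, hY⟩, rfl⟩
  rw [← ExteriorAlgebra.ιMulti_span_fixedDegree] at hX
  induction hX using Submodule.span_induction with
  | mem X hX =>
    obtain ⟨v, rfl⟩ := hX
    choose w hw using fun i => h.bijective_α.surjective (v i)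
    refine ⟨ExteriorAlgebra.ιMulti R k w, ExteriorAlgebra.ιMulti_range R k ⟨_, rfl⟩, ?_⟩
    simp [ExteriorAlgebra.ιMulti_apply, map_list_prod, List.map_ofFn, Function.comp_def, αExt_ι,
      hw]
  | zero => exact ⟨0, zero_mem _, map_zero _⟩
  | add X Y _ _ hX hY =>
    obtain ⟨X, hX, rfl⟩ := hX
    obtain ⟨Y, hY, rfl⟩ := hY
    exact ⟨X + Y, add_mem hX hY, map_add _ _ _⟩
  | smul f X _ hX =>
    obtain ⟨X, hX, rfl⟩ := hX
    obtain ⟨f, rfl⟩ := h.bijective_φ.surjective f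
    exact ⟨f • X, Submodule.smul_mem _ _ hX, αExt_smul f X⟩

/-! ### The hom-Gerstenhaber bracket with functions and with elements of degree one -/

namespace IsHomGerstenhaberBracket

variable {B B' : ExteriorAlgebra R L →ₗ[ℝ] ExteriorAlgebra R L →ₗ[ℝ] ExteriorAlgebra R L}

theorem algebraMap_mul (hB : 𝒜.IsHomGerstenhaberBracket B) (f : R) {j : ℕ}
    {Y : ExteriorAlgebra R L} (hY : Y ∈ ⋀[R]^j L) (Z : ExteriorAlgebra R L) :
    B (algebraMap R _ f) (Y * Z) = B (algebraMap R _ f) Y * 𝒜.αExt Z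
      + (-1 : ℝ) ^ j • (𝒜.αExt Y * B (algebraMap R _ f) Z) := by
  simpa using hB.leibniz 0 j _ (algebraMap_mem_zero f) Y hY Z

theorem algebraMap_ι (hB : 𝒜.IsHomGerstenhaberBracket B) (f : R) (x : L) :
    B (algebraMap R _ f) (ExteriorAlgebra.ι R x) = -algebraMap R _ (𝒜.ρ x f) := by
  simpa [hB.ι_algebraMap] using hB.skew 0 1 _ (algebraMap_mem_zero f) _ (ι_mem_one x)

/-- Bracketing with a function is a graded derivation along `α̃`, so it is determined by its values
on functions (zero for degree reasons) and on `L` (minus the anchor). -/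
theorem algebraMap_eq_zero (hB : 𝒜.IsHomGerstenhaberBracket B) {f : R}
    (hf : ∀ x, 𝒜.ρ x f = 0) (X : ExteriorAlgebra R L) : B (algebraMap R _ f) X = 0 := by
  induction X using CliffordAlgebra.left_induction with
  | algebraMap g => exact hB.degree_zero _ (algebraMap_mem_zero f) _ (algebraMap_mem_zero g)
  | add X Y hX hY => rw [map_add, hX, hY, add_zero]
  | ι_mul X x hX =>
    have := hB.algebraMap_mul f (ι_mem_one x) X
    rw [hX, hB.algebraMap_ι, hf] at this
    exact this.trans (by simp)

/-- `IsGenerator` quantifies over the bracket, so comparing two generators requires comparing their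
brackets; agreement on a first argument from `L` suffices. -/
theorem ι_eq (hB : 𝒜.IsHomGerstenhaberBracket B) (hB' : 𝒜.IsHomGerstenhaberBracket B') (x : L)
    (X : ExteriorAlgebra R L) : B (ExteriorAlgebra.ι R x) X = B' (ExteriorAlgebra.ι R x) X := by
  induction X using CliffordAlgebra.left_induction with
  | algebraMap g => exact (hB.ι_algebraMap x g).trans (hB'.ι_algebraMap x g).symm
  | add X Y hX hY => rw [map_add, map_add, hX, hY]
  | ι_mul X y hX =>
    have h := hB.leibniz 1 1 _ (ι_mem_one x) _ (ι_mem_one y) X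
    have h' := hB'.leibniz 1 1 _ (ι_mem_one x) _ (ι_mem_one y) X
    rw [hX, hB.ι_ι, ← hB'.ι_ι, ← h'] at h
    exact h

end IsHomGerstenhaberBracket

namespace IsExactGenerator

variable {B : ExteriorAlgebra R L →ₗ[ℝ] ExteriorAlgebra R L →ₗ[ℝ] ExteriorAlgebra R L}
  {D : ExteriorAlgebra R L →ₗ[ℝ] ExteriorAlgebra R L}

/-- The generating identity with a degree-0 left factor, on which `D` vanishes: the bracket with `f`
measures the failure of `D` to be `φ`-linear. -/
theorem map_smul (hD : 𝒜.IsExactGenerator B D) (f : R) (X : ExteriorAlgebra R L) :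
    D (f • X) = 𝒜.φ f • D X + B (algebraMap R _ f) X := by
  have h := hD.generates 0 _ (algebraMap_mem_zero f) X
  rw [hD.degree_zero _ (algebraMap_mem_zero f), αExt_algebraMap, ← Algebra.smul_def,
    ← Algebra.smul_def] at h
  rw [h]
  simp

theorem map_smul_of_ρ_eq_zero (hB : 𝒜.IsHomGerstenhaberBracket B)
    (hD : 𝒜.IsExactGenerator B D) {f : R} (hf : ∀ x, 𝒜.ρ x f = 0) (X : ExteriorAlgebra R L) :
    D (f • X) = 𝒜.φ f • D X := by
  rw [hD.map_smul, hB.algebraMap_eq_zero hf, add_zero]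

/-- The recursion determining `D` in all degrees from its values on `L` and the bracket. -/
theorem ι_mul (hD : 𝒜.IsExactGenerator B D) (x : L) (X : ExteriorAlgebra R L) :
    D (ExteriorAlgebra.ι R x * X) = D (ExteriorAlgebra.ι R x) * 𝒜.αExt X
      - ExteriorAlgebra.ι R (𝒜.α x) * D X - B (ExteriorAlgebra.ι R x) X := by
  have h := hD.generates 1 _ (ι_mem_one x) X
  rw [αExt_ι, pow_one, neg_one_smul, neg_one_smul] at h
  rw [h]
  abel

end IsExactGenerator

/-! ### Twisting an exact generator by a unit -/

variable (𝒜) in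
/-- The operator `X ↦ φ u • D (u⁻¹ • X)`. -/
def twist (u : Rˣ) (D : ExteriorAlgebra R L →ₗ[ℝ] ExteriorAlgebra R L) :
    ExteriorAlgebra R L →ₗ[ℝ] ExteriorAlgebra R L where
  toFun X := 𝒜.φ u • D ((↑u⁻¹ : R) • X)
  map_add' X Y := by rw [smul_add, map_add, smul_add]
  map_smul' c X := by
    rw [smul_comm, LinearMap.map_smul, smul_comm, RingHom.id_apply]

theorem twist_apply (u : Rˣ) (D : ExteriorAlgebra R L →ₗ[ℝ] ExteriorAlgebra R L)
    (X : ExteriorAlgebra R L) : 𝒜.twist u D X = 𝒜.φ u • D ((↑u⁻¹ : R) • X) := rfl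

theorem φ_mul_inv (u : Rˣ) : 𝒜.φ u * 𝒜.φ (↑u⁻¹ : R) = 1 := by
  rw [← map_mul, Units.mul_inv, map_one]

theorem ρ_one (x : L) : 𝒜.ρ x 1 = 0 := by
  simpa using 𝒜.ρ_mul x 1 1

/-- The form matches the hypothesis with `(u, f)` replaced by `(u⁻¹, -f)`, so every later result on
`u` applies to `u⁻¹` once the two representations are swapped. -/
theorem ρ_inv {u : Rˣ} {f : R} {x : L} (hu : 𝒜.ρ x u = 𝒜.φ u * 𝒜.ρ x f) :
    𝒜.ρ x (↑u⁻¹ : R) = 𝒜.φ (↑u⁻¹ : R) * 𝒜.ρ x (-f) := by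
  have h := 𝒜.ρ_mul x u (↑u⁻¹ : R)
  rw [Units.mul_inv, ρ_one, hu] at h
  have h1 := 𝒜.φ_mul_inv u
  rw [map_neg]
  linear_combination (-𝒜.φ (↑u⁻¹ : R)) * h
    - (𝒜.ρ x (↑u⁻¹ : R) + 𝒜.φ (↑u⁻¹ : R) * 𝒜.ρ x f) * h1

/-- If `u` is the exponential of `f` as far as the anchor can see and `ρ(x)[φ f] = ρ(x)[f]`, then
`φ u / u` is annihilated by the anchor. -/
theorem ρ_φ_mul_inv (h : Function.Surjective 𝒜.α) {u : Rˣ} {f : R}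
    (hu : ∀ x, 𝒜.ρ x u = 𝒜.φ u * 𝒜.ρ x f) (hf : ∀ x, 𝒜.ρ x (𝒜.φ f) = 𝒜.ρ x f) (x : L) :
    𝒜.ρ x (𝒜.φ u * (↑u⁻¹ : R)) = 0 := by
  -- Writing `x = α y` moves `φ` outside the anchor, where the exponential rule for `u` applies.
  have h1 : 𝒜.ρ x (𝒜.φ u) = 𝒜.φ (𝒜.φ u) * 𝒜.ρ x f := by
    obtain ⟨y, rfl⟩ := h x
    rw [ρ_α, hu, map_mul, ← ρ_α, hf]
  rw [ρ_mul, h1, ρ_inv (hu x), map_neg]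
  ring

theorem IsExactGenerator.twist_eq
    {B : ExteriorAlgebra R L →ₗ[ℝ] ExteriorAlgebra R L →ₗ[ℝ] ExteriorAlgebra R L}
    {D : ExteriorAlgebra R L →ₗ[ℝ] ExteriorAlgebra R L} (hD : 𝒜.IsExactGenerator B D)
    (u : Rˣ) (X : ExteriorAlgebra R L) :
    𝒜.twist u D X = D X + 𝒜.φ u • B (algebraMap R _ (↑u⁻¹ : R)) X := by
  rw [twist_apply, hD.map_smul, smul_add, smul_smul, φ_mul_inv, one_smul]

/-- The generating identity survives for any unit, since by `twist_eq` the change in `D` is a graded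
derivation along `α̃`. Only commutation with `α̃` and `D² = 0` need `φ u / u` to be annihilated by
the anchor. -/
theorem IsExactGenerator.twist
    {B : ExteriorAlgebra R L →ₗ[ℝ] ExteriorAlgebra R L →ₗ[ℝ] ExteriorAlgebra R L}
    {D : ExteriorAlgebra R L →ₗ[ℝ] ExteriorAlgebra R L} (hB : 𝒜.IsHomGerstenhaberBracket B)
    (hD : 𝒜.IsExactGenerator B D) {u : Rˣ} (hu : ∀ x, 𝒜.ρ x (𝒜.φ u * (↑u⁻¹ : R)) = 0) :
    𝒜.IsExactGenerator B (𝒜.twist u D) where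
  degree k X hX := Submodule.smul_mem _ _ (hD.degree k _ (Submodule.smul_mem _ _ hX))
  degree_zero X hX := by
    rw [twist_apply, hD.degree_zero _ (Submodule.smul_mem _ _ hX), smul_zero]
  comm_α X := by
    have h1 : (↑u⁻¹ : R) • 𝒜.αExt X =
        (𝒜.φ u * (↑u⁻¹ : R)) • 𝒜.αExt ((↑u⁻¹ : R) • X) := by
      rw [αExt_smul, smul_smul, mul_right_comm, φ_mul_inv, one_mul]
    rw [twist_apply, twist_apply, h1, hD.map_smul_of_ρ_eq_zero hB hu, hD.comm_α,
      αExt_smul, smul_smul, map_mul, mul_left_comm, φ_mul_inv, mul_one]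
  generates i X hX Y := by
    rw [hD.twist_eq, hD.twist_eq, hD.twist_eq, hD.generates i X hX Y, hB.algebraMap_mul _ hX]
    congr 1
    have h1 : ∀ (c : ℝ) (f : R) (Z : ExteriorAlgebra R L), f • c • Z = c • f • Z :=
      fun c f Z => smul_comm _ _ _
    rw [smul_add, add_mul, mul_add, smul_add, h1, smul_mul_assoc, mul_smul_comm]
    abel
  sq_zero X := by
    rw [twist_apply, twist_apply, smul_smul, mul_comm, hD.map_smul_of_ρ_eq_zero hB hu,
      hD.sq_zero, smul_zero, smul_zero]

/-! ### The generator corresponding to a representation -/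

namespace Representation

variable {n : ℕ} {rep rep₁ rep₂ : 𝒜.TopRepresentation n}
  {D D' : ExteriorAlgebra R L →ₗ[ℝ] ExteriorAlgebra R L}

/-- On `L` the value `D x` is a function, and the representation prescribes its action on the image
of `α̃`, which is all of `⋀ⁿ L`; faithfulness then pins it down. The recursion `ι_mul` does the
rest. -/
theorem IsGenerator.unique [FaithfulSMul R (⋀[R]^n L)] (h𝒜 : 𝒜.IsRegular)
    (hD : rep.IsGenerator D) (hD' : rep.IsGenerator D') : D = D' := by
  obtain ⟨B, hB, hD, hrep⟩ := hD
  obtain ⟨B', hB', hD', hrep'⟩ := hD'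
  have hι : ∀ x, D (ExteriorAlgebra.ι R x) = D' (ExteriorAlgebra.ι R x) := by
    intro x
    obtain ⟨f, hf⟩ := exists_eq_algebraMap (hD.degree 0 _ (ι_mem_one x))
    obtain ⟨f', hf'⟩ := exists_eq_algebraMap (hD'.degree 0 _ (ι_mem_one x))
    rw [hf, hf']
    congr 1
    refine FaithfulSMul.eq_of_smul_eq_smul (α := ⋀[R]^n L) fun X => ?_
    obtain ⟨X, rfl⟩ := h𝒜.αPow_surjective n X
    have h := hrep x X
    have h' := hrep' x X
    rw [hB.ι_eq hB', ← h', hf, hf', ← Algebra.smul_def, ← Algebra.smul_def] at h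
    exact Subtype.ext h
  ext X
  induction X using CliffordAlgebra.left_induction with
  | algebraMap f =>
    exact (hD.degree_zero _ (algebraMap_mem_zero f)).trans
      (hD'.degree_zero _ (algebraMap_mem_zero f)).symm
  | add X Y hX hY => rw [map_add, map_add, hX, hY]
  | ι_mul X x hX =>
    have h := hD.ι_mul x X
    rw [hι, hX, hB.ι_eq hB', ← hD'.ι_mul] at h
    exact h

theorem IsGenerator.generator_eq [FaithfulSMul R (⋀[R]^n L)] (h𝒜 : 𝒜.IsRegular)
    (hD : rep.IsGenerator D) : rep.generator = D := by
  have h : ∃ D, rep.IsGenerator D := ⟨D, hD⟩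
  rw [generator, dif_pos h]
  exact IsGenerator.unique h𝒜 h.choose_spec hD

/-- Handles the default value of `generator`, so that no existence proof for `D_∇` is needed. -/
theorem generator_eq_zero (h : ¬∃ D, rep.IsGenerator D) : rep.generator = 0 := by
  rw [generator, dif_neg h]

theorem generator_smul {f : R} (hf : ∀ x, 𝒜.ρ x f = 0) (X : ExteriorAlgebra R L) :
    rep.generator (f • X) = 𝒜.φ f • rep.generator X := by
  by_cases h : ∃ D, rep.IsGenerator D
  · rw [generator, dif_pos h]
    obtain ⟨B, hB, hD, -⟩ := h.choose_spec
    exact hD.map_smul_of_ρ_eq_zero hB hf X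
  · simp [generator_eq_zero h]

/-! ### Homotopic representations -/

/-- Trades the `α⁻¹` inside `d f` for a `φ` on `f`. -/
theorem φ_d (h𝒜 : 𝒜.IsRegular) (f : R) (x : L) : 𝒜.φ (h𝒜.d f x) = 𝒜.ρ x (𝒜.φ f) := by
  have h : 𝒜.α (h𝒜.αInv x) = x := (LinearEquiv.ofBijective 𝒜.α h𝒜.bijective_α).apply_symm_apply x
  change 𝒜.φ (𝒜.ρ (h𝒜.αInv x) f) = _
  rw [← ρ_α, h]

theorem IsHomotopy.symm {h𝒜 : 𝒜.IsRegular} {f : R} (hf : IsHomotopy h𝒜 rep₁ rep₂ f) :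
    IsHomotopy h𝒜 rep₂ rep₁ (-f) := by
  intro x X
  rw [φ_d, map_neg, map_neg, ← φ_d h𝒜, ← neg_sub, hf x X]
  exact (neg_smul (𝒜.φ (h𝒜.d f x)) (𝒜.αPow n X)).symm

/-- Equivariance of both representations forces the form `d f` to be `φ`-invariant. -/
theorem IsHomotopy.ρ_φ [FaithfulSMul R (⋀[R]^n L)] {h𝒜 : 𝒜.IsRegular} {f : R}
    (hf : IsHomotopy h𝒜 rep₁ rep₂ f) (x : L) : 𝒜.ρ x (𝒜.φ f) = 𝒜.ρ x f := by
  apply h𝒜.bijective_φ.injective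
  refine FaithfulSMul.eq_of_smul_eq_smul (α := ⋀[R]^n L) fun X => ?_
  obtain ⟨X, rfl⟩ := h𝒜.αPow_surjective n X
  -- Applying `α̃` to the homotopy relation compares coefficients of `α̃ (α̃ X)`, hence the second
  -- lift.
  obtain ⟨X, rfl⟩ := h𝒜.αPow_surjective n X
  have h := hf (𝒜.α x) (𝒜.αPow n X)
  rw [rep₁.nabla_α, rep₂.nabla_α, ← αPow_sub, hf x X, αPow_smul, φ_d, φ_d, ρ_α] at h
  exact h

variable [FaithfulSMul R (⋀[R]^n L)] {h𝒜 : 𝒜.IsRegular} {f : R} {u : Rˣ}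

/-- The twist adds `φ u • B(u⁻¹, x) = -φ u · ρ(x)[u⁻¹] = ρ(x)[f]` to `D x`, which is what passing
from `∇¹` to `∇²` requires. -/
theorem IsHomotopy.isGenerator_twist (hf : IsHomotopy h𝒜 rep₁ rep₂ f)
    (hu : ∀ x, 𝒜.ρ x u = 𝒜.φ u * 𝒜.ρ x f) (hD : rep₁.IsGenerator D) :
    rep₂.IsGenerator (𝒜.twist u D) := by
  obtain ⟨B, hB, hD, hrep⟩ := hD
  refine ⟨B, hB, hD.twist hB (ρ_φ_mul_inv h𝒜.bijective_α.surjective hu hf.ρ_φ), fun x X => ?_⟩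
  have h : rep₂.nabla x X = rep₁.nabla x X - 𝒜.ρ x f • 𝒜.αPow n X := by
    rw [← hf.ρ_φ, ← φ_d h𝒜, ← hf x X, sub_sub_cancel]
  have h' : 𝒜.φ u • -algebraMap R (ExteriorAlgebra R L) (𝒜.ρ x (↑u⁻¹ : R))
      = algebraMap R _ (𝒜.ρ x f) := by
    rw [ρ_inv (hu x), ← map_neg, Algebra.smul_def, ← map_mul, ← mul_neg, ← mul_assoc, φ_mul_inv,
      map_neg, neg_neg, one_mul]
  rw [hD.twist_eq, add_mul, hrep, h, hB.algebraMap_ι, h', ← Algebra.smul_def,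
    AddSubgroupClass.coe_sub]
  change _ + _ = _ - (_ - 𝒜.ρ x f • 𝒜.αExt X)
  abel

theorem IsHomotopy.generator_smul (hf : IsHomotopy h𝒜 rep₁ rep₂ f)
    (hu : ∀ x, 𝒜.ρ x u = 𝒜.φ u * 𝒜.ρ x f) (X : ExteriorAlgebra R L) :
    rep₂.generator ((u : R) • X) = 𝒜.φ u • rep₁.generator X := by
  by_cases h : ∃ D, rep₁.IsGenerator D
  · obtain ⟨D, hD⟩ := h
    rw [hD.generator_eq h𝒜, (hf.isGenerator_twist hu hD).generator_eq h𝒜, twist_apply, smul_smul,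
      Units.inv_mul, one_smul]
  -- Twisting back by `u⁻¹` shows that both generators exist or neither does; in the latter case
  -- both are zero.
  · have h' : ¬∃ D, rep₂.IsGenerator D := fun ⟨D, hD⟩ =>
      h ⟨_, hf.symm.isGenerator_twist (u := u⁻¹) (fun x => ρ_inv (hu x)) hD⟩
    simp [generator_eq_zero h, generator_eq_zero h']

theorem IsHomotopy.smul_mem_cycles (hf : IsHomotopy h𝒜 rep₁ rep₂ f)
    (hu : ∀ x, 𝒜.ρ x u = 𝒜.φ u * 𝒜.ρ x f) {k : ℕ} {X : ExteriorAlgebra R L}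
    (hX : X ∈ rep₁.cycles k) : (u : R) • X ∈ rep₂.cycles k := by
  refine ⟨Submodule.smul_mem (⋀[R]^k L) _ hX.1, ?_⟩
  have hX' : rep₁.generator X = 0 := hX.2
  rw [SetLike.mem_coe, LinearMap.mem_ker, hf.generator_smul hu, hX', smul_zero]

theorem IsHomotopy.smul_mem_boundaries (hf : IsHomotopy h𝒜 rep₁ rep₂ f)
    (hu : ∀ x, 𝒜.ρ x u = 𝒜.φ u * 𝒜.ρ x f) {k : ℕ} {X : ExteriorAlgebra R L}
    (hX : X ∈ rep₁.boundaries k) : (u : R) • X ∈ rep₂.boundaries k := by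
  obtain ⟨Y, hY, rfl⟩ := hX
  -- With `φ v = u / φ u` and `v` killed by the anchor, `D₂ (u v Y) = φ u • φ v • D₁ Y = u • D₁ Y`.
  obtain ⟨v, hv⟩ := h𝒜.bijective_φ.surjective (𝒜.φ (↑u⁻¹ : R) * u)
  have hv' : ∀ x, 𝒜.ρ x v = 0 := by
    intro x
    apply h𝒜.bijective_φ.injective
    rw [← ρ_α, hv, map_zero]
    simpa using ρ_φ_mul_inv h𝒜.bijective_α.surjective (u := u⁻¹)
      (fun x => ρ_inv (hu x)) hf.symm.ρ_φ (𝒜.α x)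
  refine ⟨(u : R) • v • Y,
    Submodule.smul_mem (⋀[R]^(k + 1) L) _ (Submodule.smul_mem _ _ hY), ?_⟩
  rw [hf.generator_smul hu, Representation.generator_smul hv', hv, smul_smul, ← mul_assoc,
    φ_mul_inv, one_mul]

/-- Multiplication by `u = e^f` as an isomorphism between the cycles of homotopic
representations. -/
def IsHomotopy.cyclesEquiv (hf : IsHomotopy h𝒜 rep₁ rep₂ f)
    (hu : ∀ x, 𝒜.ρ x u = 𝒜.φ u * 𝒜.ρ x f) (k : ℕ) : rep₁.cycles k ≃ₗ[ℝ] rep₂.cycles k where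
  toFun z := ⟨(u : R) • z.1, hf.smul_mem_cycles hu z.2⟩
  map_add' z w := Subtype.ext (smul_add _ _ _)
  map_smul' c z := Subtype.ext (smul_comm _ _ _)
  invFun z := ⟨(↑u⁻¹ : R) • z.1,
    hf.symm.smul_mem_cycles (u := u⁻¹) (fun x => ρ_inv (hu x)) z.2⟩
  left_inv z := Subtype.ext (by simp [smul_smul])
  right_inv z := Subtype.ext (by simp [smul_smul])

/-- Multiplication by `u = e^f` as an isomorphism between the homologies of homotopic
representations. -/
def IsHomotopy.homologyEquiv (hf : IsHomotopy h𝒜 rep₁ rep₂ f)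
    (hu : ∀ x, 𝒜.ρ x u = 𝒜.φ u * 𝒜.ρ x f) (k : ℕ) : rep₁.Homology k ≃ₗ[ℝ] rep₂.Homology k :=
  Submodule.Quotient.equiv _ _ (hf.cyclesEquiv hu k) <| by
    apply le_antisymm
    · rintro _ ⟨z, hz, rfl⟩
      exact hf.smul_mem_boundaries hu hz
    · intro z hz
      refine ⟨(hf.cyclesEquiv hu k).symm z, ?_, LinearEquiv.apply_symm_apply _ z⟩
      exact hf.symm.smul_mem_boundaries (u := u⁻¹) (fun x => ρ_inv (hu x)) hz

theorem IsHomotopy.homologyEquiv_homologyClass (hf : IsHomotopy h𝒜 rep₁ rep₂ f)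
    (hu : ∀ x, 𝒜.ρ x u = 𝒜.φ u * 𝒜.ρ x f) (k : ℕ) (z : rep₁.cycles k) :
    hf.homologyEquiv hu k (rep₁.homologyClass k z)
      = rep₂.homologyClass k (hf.cyclesEquiv hu k z) := rfl

end Representation

end HomLieRinehart

end HomLie

end
-- Smooth sections: faithfulness of the top exterior power, and exponentials.
noncomputable section

namespace HomLie

section Sections

variable {d : ℕ} {M : Type*} [TopologicalSpace M] [ChartedSpace (EuclideanSpace ℝ (Fin d)) M]
  {F : Type*} [NormedAddCommGroup F] [NormedSpace ℝ F]
  {V : M → Type*} [TopologicalSpace (Bundle.TotalSpace F V)]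
  [∀ m, AddCommGroup (V m)] [∀ m, Module ℝ (V m)] [∀ m, TopologicalSpace (V m)]
  [FiberBundle F V] [VectorBundle ℝ F V]

/-- Every vector of a smooth vector bundle is the value of a smooth section. -/
theorem exists_section_eq [T2Space M] [IsManifold (𝓡 d) ∞ M] [ContMDiffVectorBundle ∞ F V (𝓡 d)]
    (m : M) (v : V m) : ∃ s : Sections d F V, s m = v := by
  obtain ⟨U, hU, hs⟩ := FiberBundle.exists_contMDiffOn_extend (k := ∞) (𝓡 d) F v
  obtain ⟨U', hU', hU'o, hm⟩ := mem_nhds_iff.mp hU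
  -- A bump function at `m`, supported where the local extension of `v` is smooth, makes it global
  -- without changing the value at `m`.
  obtain ⟨ψ, hψ, -⟩ := (SmoothBumpFunction.nhds_basis_support (I := 𝓡 d)
    (hU'o.mem_nhds hm)).mem_iff.mp (hU'o.mem_nhds hm)
  refine ⟨⟨_, ψ.contMDiff.contMDiffOn.smul_section_of_tsupport hU'o hψ (hs.mono hU')⟩, ?_⟩
  change ψ m • FiberBundle.extend F v m = v
  rw [ψ.eq_one, one_smul, FiberBundle.extend_apply_self]

/-- An alternating form on the fibre at `m` detects the values at `m` of the coefficients of a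
decomposable element of the exterior power of the module of sections. -/
theorem mul_eq_mul_of_smul_ιMulti_eq {n : ℕ} (m : M) (η : V m [⋀^Fin n]→ₗ[ℝ] ℝ)
    {f g : SmoothFn d M} {s : Fin n → Sections d F V}
    (h : f • exteriorPower.ιMulti (SmoothFn d M) n s =
      g • exteriorPower.ιMulti (SmoothFn d M) n s) :
    f m * η (fun i => s i m) = g m * η (fun i => s i m) := by
  let ev : SmoothFn d M →+* ℝ :=
    { toFun := fun f => f m
      map_one' := rfl
      map_mul' := fun _ _ => rfl
      map_zero' := rfl
      map_add' := fun _ _ => rfl }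
  -- Evaluation at `m` makes `ℝ` a module over the smooth functions, so that `η` after evaluation is
  -- alternating over them and factors through the exterior power.
  let _ : Module (SmoothFn d M) ℝ := Module.compHom ℝ ev
  have hupd : ∀ [DecidableEq (Fin n)] (s : Fin n → Sections d F V) (i : Fin n)
      (x : Sections d F V), (fun j => Function.update s i x j m) =
        Function.update (fun j => s j m) i (x m) := fun s i x =>
    funext (Function.apply_update (fun _ (t : Sections d F V) => t m) s i x)
  let Ω : Sections d F V [⋀^Fin n]→ₗ[SmoothFn d M] ℝ :=
    { toFun := fun s => η fun i => s i m
      map_update_add' := fun s i x y => by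
        simp only [hupd]
        exact η.map_update_add _ i (x m) (y m)
      map_update_smul' := fun s i c x => by
        simp only [hupd]
        exact η.map_update_smul _ i (c m) (x m)
      map_eq_zero_of_eq' := fun s i j hij hne =>
        η.map_eq_zero_of_eq _ (congrArg (fun t : Sections d F V => t m) hij) hne }
  have h' := congrArg (exteriorPower.alternatingMapLinearEquiv Ω) h
  rw [map_smul, map_smul, exteriorPower.alternatingMapLinearEquiv_apply_ιMulti] at h'
  exact h'

/-- The top exterior power of the module of sections of a vector bundle is faithful. -/
theorem faithfulSMul_exteriorPower_sections [T2Space M] [IsManifold (𝓡 d) ∞ M]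
    [FiniteDimensional ℝ F] [ContMDiffVectorBundle ∞ F V (𝓡 d)] {n : ℕ}
    (hn : Module.finrank ℝ F = n) :
    FaithfulSMul (SmoothFn d M) (⋀[SmoothFn d M]^n (Sections d F V)) where
  eq_of_smul_eq_smul {f g} h := by
    ext m
    let e : V m ≃ₗ[ℝ] F := (trivializationAt F V m).linearEquivAt ℝ m
      (FiberBundle.mem_baseSet_trivializationAt' m)
    -- Sections through a basis of the fibre have determinant 1 at `m`, which isolates the values of
    -- `f` and `g` there.
    let b : Module.Basis (Fin n) ℝ (V m) := (Module.finBasisOfFinrankEq ℝ F hn).map e.symm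
    choose s hs using fun i => exists_section_eq (d := d) (F := F) m (b i)
    have h1 := mul_eq_mul_of_smul_ιMulti_eq m b.det (h (exteriorPower.ιMulti _ n s))
    have h2 : (fun i => s i m) = b := funext hs
    rwa [h2, b.det_self, mul_one, mul_one] at h1

/-- The exponential of a smooth function as a unit. -/
def SmoothFn.expUnit (f : SmoothFn d M) : (SmoothFn d M)ˣ where
  val := f.exp
  inv := (-f).exp
  val_inv := by
    ext m
    change Real.exp (f m) * Real.exp (-f m) = 1
    rw [← Real.exp_add, add_neg_cancel, Real.exp_zero]
  inv_val := by
    ext m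
    change Real.exp (-f m) * Real.exp (f m) = 1
    rw [← Real.exp_add, neg_add_cancel, Real.exp_zero]

/-- The chain rule. This is the only property of `e^f`, beyond invertibility, that the algebraic
part uses. -/
theorem Anchor.act_exp [IsManifold (𝓡 d) ∞ M] {φ : C^∞⟮𝓡 d, M; 𝓡 d, M⟯} (ρ : Anchor F V φ)
    (X : Sections d F V) (f : SmoothFn d M) :
    ρ.act X f.exp = pullback φ f.exp * ρ.act X f := by
  ext m
  have hf : MDifferentiableAt (𝓡 d) 𝓘(ℝ, ℝ) f (φ m) := f.mdifferentiableAt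
  have he : HasMFDerivAt 𝓘(ℝ, ℝ) 𝓘(ℝ, ℝ) Real.exp (f (φ m)) _ :=
    (Real.hasDerivAt_exp (f (φ m))).hasFDerivAt.hasMFDerivAt
  have h : mfderiv (𝓡 d) 𝓘(ℝ, ℝ) f.exp (φ m) = _ := (he.comp (φ m) hf.hasMFDerivAt).mfderiv
  refine (DFunLike.congr_fun h (ρ.toFun m (X (φ m)))).trans ?_
  exact mul_comm (ρ.act X f m) (Real.exp (f (φ m)))

end Sections

end HomLie

end

open HomLie HomLieRinehart in
theorem mainTheorem8 {d n : ℕ} {M : Type*} [TopologicalSpace M] [T2Space M]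
    [SecondCountableTopology M] [ChartedSpace (EuclideanSpace ℝ (Fin d)) M]
    [IsManifold (𝓡 d) ∞ M]
    {F : Type*} [NormedAddCommGroup F] [NormedSpace ℝ F] [FiniteDimensional ℝ F]
    (hn : Module.finrank ℝ F = n)
    {V : M → Type*} [TopologicalSpace (Bundle.TotalSpace F V)]
    [∀ m, AddCommGroup (V m)] [∀ m, Module ℝ (V m)] [∀ m, TopologicalSpace (V m)]
    [FiberBundle F V] [VectorBundle ℝ F V] [ContMDiffVectorBundle ∞ F V (𝓡 d)]
    (𝒜 : HomLieAlgebroid d F V) (h𝒜 : 𝒜.IsRegular)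
    (rep₁ rep₂ : 𝒜.toHomLieRinehart.TopRepresentation n)
    (hom : Representation.Homotopic h𝒜.toHomLieRinehart rep₁ rep₂) :
    (∀ k, Nonempty (rep₁.Homology k ≃ₗ[ℝ] rep₂.Homology k)) ∧
    ∀ f, Representation.IsHomotopy h𝒜.toHomLieRinehart rep₁ rep₂ f →
      ∀ k, ∃ e : rep₁.Homology k ≃ₗ[ℝ] rep₂.Homology k, ∀ z : rep₁.cycles k,
        ∃ w : rep₂.cycles k, (w : ExteriorAlgebra (SmoothFn d M) (Sections d F V)) = f.exp • z.1 ∧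
          e (rep₁.homologyClass k z) = rep₂.homologyClass k w := by
  have := faithfulSMul_exteriorPower_sections (d := d) (M := M) (V := V) hn
  have hu : ∀ f x, 𝒜.toHomLieRinehart.ρ x f.expUnit =
      𝒜.toHomLieRinehart.φ f.expUnit * 𝒜.toHomLieRinehart.ρ x f :=
    fun f x => 𝒜.anchor.act_exp x f
  obtain ⟨f, hf⟩ := hom
  exact ⟨fun k => ⟨hf.homologyEquiv (hu f) k⟩, fun f hf k => ⟨hf.homologyEquiv (hu f) k,
    fun z => ⟨hf.cyclesEquiv (hu f) k z, rfl, hf.homologyEquiv_homologyClass (hu f) k z⟩⟩⟩
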